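/- \textbf{Setting.} Let $(V,\mu)$ be a finite metric space with intervals $I(x,y)=\{z:\mu(x,z)+\mu(z,y)=\mu(x,y)\}$, and suppose that $\mu$ is modular, i.e. $I(x,y)\cap I(y,z)\cap I(x,z)\neq\varnothing$ for all $x,y,z\in V$. Let $H_\mu$ be the graph on $V$ with an edge $xy$ ($x\ne y$) iff $\mu(x,y)<\mu(x,z)+\mu(z,y)$ for all $z\in V\setminus\{x,y\}$ (the edge has weight $\mu(x,y)$, and $\mu$ is the path metric). Let $\to$ be an admissible orientation of $H_\mu$: every edge is oriented in exactly one direction, and for every 4-cycle $x_1,x_2,x_3,x_4$, $x_1\to x_2$ implies $x_4\to x_3$. Then $\Gamma=(H_\mu,\to)$ is called a modular complex. Write $p\preceq q$ if there is a directed path from $p$ to $q$, $[p,q]=\{x: p\preceq x\preceq q\}$, and $\vee,\wedge$ for joins and meets with respect to $\preceq$. Let $\sqsubseteq$ be an admissible relation on $V$: $p\sqsubseteq q$ implies $p\preceq q$; $p\sqsubseteq p$ for all $p$; $p\to q$ implies $p\sqsubseteq q$; (a) if $p\sqsubseteq q$, $a\preceq b$ and $a,b\in[p,q]$ then $a\sqsubseteq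 b$; (b) if $p\sqsubseteq q_1$, $p\sqsubseteq q_2$ and $q_1\vee q_2$ exists then $p\sqsubseteq q_1\vee q_2$; (c) if $p_1\sqsubseteq q$, $p_2\sqsubseteq q$ and $p_1\wedge p_2$ exists then $p_1\wedge p_2\sqsubseteq q$. The pair $(\Gamma,\sqsubseteq)$ is an extended modular complex. A sequence $(u_0,\dots,u_k)$ is a shortest subpath if $\mu(u_0,u_k)=\sum_{i=1}^{k}\mu(u_{i-1},u_i)$. The gate of $q$ at a set $U\subseteq V$ is the element $g\in U$ with $\mu(q,u)=\mu(q,g)+\mu(g,u)$ for all $u\in U$. Let $p\triangleright q$ be the gate of $q$ at $\{x:p\sqsubseteq x\}$, let $p\triangleleft q$ be the gate of $q$ at $\{x:x\sqsubseteq p\}$, and let $p\diamond q$ be the join of $p\triangleright q$ and $p\triangleleft q$ in $I(p,q)$ ordered by: $x\preceq_{pq}y$ iff $(p,x,y,q)$ is a shortest subpath. Put $p\diamond^0q=p$ and $p\diamond^{k+1}q=(p\diamond^kq)\diamond q$. Vertices $p,q$ are $\diamond$-neighbors if $p,q\in[a,b]$ for some $a\sqsubseteq b$. The thickening $\Gamma^\diamond$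 is the simple graph on $V$ whose edges join distinct $\diamond$-neighbors, and a $\diamond$-path is a path in $\Gamma^\diamond$ (vertices may repeat). The normal $p$-$q$ path is $(p\diamond^0q,p\diamond^1q,\dots,p\diamond^kq)$, where $k$ is the least index with $p\diamond^kq=q$. \textbf{Theorem.} Let $\Gamma$ be an extended modular complex and $p,q\in V$. The elements $p\triangleright q$, $p\triangleleft q$ and $p\diamond q$ are well defined. If $(p_0,p_1,\dots,p_k)$ is a $\diamond$-path with $p_0=p$, then $(p_i,\,p\diamond^iq,\,q)$ is a shortest subpath for every $i\in\{0,\dots,k\}$. In particular, if $q=p_k$ then $p\diamond^kq=q$. Hence the normal $p$-$q$ path exists, is a $\diamond$-path, and is a shortest $\diamond$-path from $p$ to $q$ (a shortest path from $p$ to $q$ in $\Gamma^\diamond$). -/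

import Mathlib

/-- The metric interval `I(x, y) = {z | μ(x, z) + μ(z, y) = μ(x, y)}`, where `μ = dist`. -/
def metricInterval {V : Type*} [MetricSpace V] (x y : V) : Set V :=
  {z | dist x z + dist z y = dist x y}

/-- A metric is modular if every triple of points has a median. -/
def IsModularMetric (V : Type*) [MetricSpace V] : Prop :=
  ∀ x y z : V, (metricInterval x y ∩ metricInterval y z ∩ metricInterval x z).Nonempty

/-- The graph `H_μ` of a metric `μ = dist`: the edges are the pairs `xy` with
`μ(x, y) < μ(x, z) + μ(z, y)` for all other points `z`.  (The weight of an edge is its `μ`-length;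
on a finite set, `μ` is the path metric of the weighted graph `H_μ`.) -/
def metricGraph (V : Type*) [MetricSpace V] : SimpleGraph V where
  Adj x y := x ≠ y ∧ ∀ z, z ≠ x → z ≠ y → dist x y < dist x z + dist z y
  symm := ⟨fun x y h => ⟨h.1.symm, fun z hy hx => by
    have := h.2 z hx hy
    rw [dist_comm y x, dist_comm y z, dist_comm z x]
    linarith⟩⟩
  loopless := ⟨fun _ h => h.1 rfl⟩

/-- `arrow` orients every edge of `H` in exactly one of the two directions. -/
structure IsOrientation {V : Type*} (H : SimpleGraph V) (arrow : V → V → Prop) : Prop where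
  adj_iff : ∀ x y, H.Adj x y ↔ arrow x y ∨ arrow y x
  asymm : ∀ x y, arrow x y → ¬ arrow y x

/-- An orientation is admissible if in every 4-cycle `x₁x₂x₃x₄`, `x₁ → x₂` implies `x₄ → x₃`. -/
structure IsAdmissibleOrientation {V : Type*} (H : SimpleGraph V) (arrow : V → V → Prop) : Prop
    extends IsOrientation H arrow where
  four_cycle : ∀ x₁ x₂ x₃ x₄, H.Adj x₁ x₂ → H.Adj x₂ x₃ → H.Adj x₃ x₄ → H.Adj x₄ x₁ →
    x₁ ≠ x₃ → x₂ ≠ x₄ → arrow x₁ x₂ → arrow x₄ x₃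

/-- A modular complex (oriented modular graph) on `V`: the metric `μ = dist` is modular, and `arrow`
is an admissible orientation of the weighted graph `H_μ`. -/
structure ModularComplex (V : Type*) [MetricSpace V] where
  modular : IsModularMetric V
  arrow : V → V → Prop
  admissible : IsAdmissibleOrientation (metricGraph V) arrow

namespace ModularComplex

variable {V : Type*} [MetricSpace V]

/-- The order `⪯` induced by the (acyclic) oriented graph: `p ⪯ q` if there is a directed path
from `p` to `q`. -/
def le (Γ : ModularComplex V) : V → V → Prop := Relation.ReflTransGen Γ.arrow

/-- The order interval `[a, b]`. -/
def interval (Γ : ModularComplex V) (a b : V) : Set V := {x | Γ.le a x ∧ Γ.le x b}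

/-- `j` is the join `x ∨ y`. -/
def IsJoin (Γ : ModularComplex V) (x y j : V) : Prop :=
  Γ.le x j ∧ Γ.le y j ∧ ∀ z, Γ.le x z → Γ.le y z → Γ.le j z

/-- `m` is the meet `x ∧ y`. -/
def IsMeet (Γ : ModularComplex V) (x y m : V) : Prop :=
  Γ.le m x ∧ Γ.le m y ∧ ∀ z, Γ.le z x → Γ.le z y → Γ.le z m

/-- Admissibility of a binary relation `⊑` on a modular complex. -/
structure IsAdmissibleRel (Γ : ModularComplex V) (r : V → V → Prop) : Prop where
  le_of_rel : ∀ p q, r p q → Γ.le p q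
  refl : ∀ p, r p p
  of_arrow : ∀ p q, Γ.arrow p q → r p q
  of_mem_interval : ∀ p q a b, r p q → Γ.le a b → a ∈ Γ.interval p q → b ∈ Γ.interval p q → r a b
  join : ∀ p q₁ q₂ j, r p q₁ → r p q₂ → Γ.IsJoin q₁ q₂ j → r p j
  meet : ∀ p₁ p₂ q m, r p₁ q → r p₂ q → Γ.IsMeet p₁ p₂ m → r m q

end ModularComplex

/-- An extended modular complex: a modular complex with an admissible relation `⊑`. -/
structure ExtendedModularComplex (V : Type*) [MetricSpace V] extends ModularComplex V where
  rel : V → V → Prop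
  rel_admissible : toModularComplex.IsAdmissibleRel rel

/-- `(u₀, …, u_k)` is a shortest subpath:
`μ(u₀, u_k) = μ(u₀, u₁) + μ(u₁, u₂) + ⋯ + μ(u_{k-1}, u_k)`. -/
def IsShortestSubpath {V : Type*} [MetricSpace V] {k : ℕ} (u : Fin (k + 1) → V) : Prop :=
  dist (u 0) (u (Fin.last k)) = ∑ i : Fin k, dist (u i.castSucc) (u i.succ)

/-- `g` is the gate of `q` at the set `U`. -/
def IsGate {V : Type*} [MetricSpace V] (U : Set V) (q g : V) : Prop :=
  g ∈ U ∧ ∀ u ∈ U, dist q u = dist q g + dist g u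

/-- The order `⪯_{pq}` on `I(p, q)`: `x ⪯_{pq} y` iff `(p, x, y, q)` is a shortest subpath. -/
def intervalLE {V : Type*} [MetricSpace V] (p q x y : V) : Prop :=
  IsShortestSubpath ![p, x, y, q]

/-- `j` is the join `x ∨_{pq} y` in the poset `(I(p, q), ⪯_{pq})`. -/
def IsIntervalJoin {V : Type*} [MetricSpace V] (p q x y j : V) : Prop :=
  j ∈ metricInterval p q ∧ intervalLE p q x j ∧ intervalLE p q y j ∧
    ∀ z ∈ metricInterval p q, intervalLE p q x z → intervalLE p q y z → intervalLE p q j z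

namespace ExtendedModularComplex

variable {V : Type*} [MetricSpace V]

/-- `ℒ⁺_p = {x | p ⊑ x}`. -/
def upperNbhd (Γ : ExtendedModularComplex V) (p : V) : Set V := {x | Γ.rel p x}

/-- `ℒ⁻_p = {x | x ⊑ p}`. -/
def lowerNbhd (Γ : ExtendedModularComplex V) (p : V) : Set V := {x | Γ.rel x p}

/-- `p ▷ q`, the gate of `q` at `ℒ⁺_p`. -/
noncomputable def upGate (Γ : ExtendedModularComplex V) (p q : V) : V :=
  @Classical.epsilon V ⟨p⟩ (IsGate (Γ.upperNbhd p) q)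

/-- `p ◁ q`, the gate of `q` at `ℒ⁻_p`. -/
noncomputable def downGate (Γ : ExtendedModularComplex V) (p q : V) : V :=
  @Classical.epsilon V ⟨p⟩ (IsGate (Γ.lowerNbhd p) q)

/-- `p ◇ q = (p ▷ q) ∨_{pq} (p ◁ q)`. -/
noncomputable def diamond (Γ : ExtendedModularComplex V) (p q : V) : V :=
  @Classical.epsilon V ⟨p⟩ (IsIntervalJoin p q (Γ.upGate p q) (Γ.downGate p q))

/-- `p ◇^k q`: `p ◇^0 q = p` and `p ◇^(k+1) q = (p ◇^k q) ◇ q`. -/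
noncomputable def diamondIter (Γ : ExtendedModularComplex V) (p q : V) : ℕ → V
  | 0 => p
  | k + 1 => Γ.diamond (Γ.diamondIter p q k) q

/-- `p`, `q` are `◇`-neighbors if `p, q ∈ [a, b]` for some `a ⊑ b`. -/
def DiamondNeighbors (Γ : ExtendedModularComplex V) (p q : V) : Prop :=
  ∃ a b, Γ.rel a b ∧ p ∈ Γ.interval a b ∧ q ∈ Γ.interval a b

/-- The thickening `Γ^◇`: distinct vertices are adjacent iff they are `◇`-neighbors.
Its walks are the `◇`-paths. -/
def thickening (Γ : ExtendedModularComplex V) : SimpleGraph V where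
  Adj p q := p ≠ q ∧ Γ.DiamondNeighbors p q
  symm := ⟨fun _ _ h => ⟨h.1.symm, by
    obtain ⟨a, b, hab, hp, hq⟩ := h.2
    exact ⟨a, b, hab, hq, hp⟩⟩⟩
  loopless := ⟨fun _ h => h.1 rfl⟩

/-- The `◇`-path `P` is the normal `p`-`q` path `(p ◇^0 q, …, p ◇^k q)`, where `k` is the least
index with `p ◇^k q = q`. -/
def IsNormalPath (Γ : ExtendedModularComplex V) {p q : V} (P : Γ.thickening.Walk p q) : Prop :=
  IsLeast {k | Γ.diamondIter p q k = q} P.length ∧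
    ∀ i ≤ P.length, P.getVert i = Γ.diamondIter p q i

end ExtendedModularComplex

/-! ### Metric intervals, medians and gates in modular metric spaces -/

section MetricInterval

variable {V : Type*} [MetricSpace V] {a b c d x y z w q : V}

/-! Directed paths turn out to be geodesics, so order intervals and the neighborhoods `ℒ⁺_p`, `ℒ⁻_p`
are metrically convex. In a finite modular space nonempty convex sets are gated, which gives `p ▷ q`
and `p ◁ q`; and `p ◇ q` is the gate of `q` at the order interval `[p ◁ q, p ▷ q]`.

Two facts then carry the comparison with an arbitrary `◇`-path. If `x` is a `◇`-neighbor of `p`,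
then `p ◇ q` lies on a geodesic from `x` to `q`: one step cannot beat `◇`
(`DiamondNeighbors.diamond_mem`). If `x ∈ I(p, q)`, then `x ◇ q ∈ I(p ◇ q, q)`: starting closer
never hurts (`diamond_mem_of_mem`). Together they give `p ◇^i q ∈ I(p_i, q)` by induction on `i`.

The normal path is itself a `◇`-path because `p ◁ q ⊑ p ▷ q` (`downGate_rel_upGate`), which follows
by transporting `⊑` across a metric rectangle. -/

theorem mem_metricInterval : z ∈ metricInterval x y ↔ dist x z + dist z y = dist x y := Iff.rfl

theorem mem_metricInterval_symm (h : z ∈ metricInterval x y) : z ∈ metricInterval y x := by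
  rw [mem_metricInterval] at *
  linarith [dist_comm x y, dist_comm x z, dist_comm y z]

theorem left_mem_metricInterval (x y : V) : x ∈ metricInterval x y := by
  simp [mem_metricInterval]

theorem right_mem_metricInterval (x y : V) : y ∈ metricInterval x y := by
  simp [mem_metricInterval]

theorem metricInterval_trans (hb : b ∈ metricInterval a d) (hc : c ∈ metricInterval b d) :
    c ∈ metricInterval a d := by
  rw [mem_metricInterval] at *
  linarith [dist_triangle a c d, dist_triangle a b c]

theorem metricInterval_trans_left (hb : b ∈ metricInterval a d) (hc : c ∈ metricInterval b d) :
    b ∈ metricInterval a c := by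
  rw [mem_metricInterval] at *
  linarith [dist_triangle a c d, dist_triangle a b c]

theorem dist_lt_of_mem_metricInterval (h : z ∈ metricInterval x y) (hz : z ≠ x) :
    dist z y < dist x y := by
  rw [mem_metricInterval] at h
  linarith [dist_pos.2 hz.symm]

/-- Induction on the distance in a finite metric space. -/
theorem dist_induction [Finite V] {P : V → V → Prop}
    (h : ∀ x y, (∀ x' y', dist x' y' < dist x y → P x' y') → P x y) (x y : V) : P x y := by
  let r : V × V → V × V → Prop := fun s t => dist s.1 s.2 < dist t.1 t.2
  have : IsTrans (V × V) r := ⟨fun _ _ _ h₁ h₂ => lt_trans h₁ h₂⟩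
  have : Std.Irrefl r := ⟨fun _ h => lt_irrefl _ h⟩
  have hr : WellFounded r := Finite.wellFounded_of_trans_of_irrefl r
  have : ∀ s : V × V, P s.1 s.2 := fun s =>
    hr.induction (C := fun s => P s.1 s.2) s fun s ih => h _ _ fun x' y' hlt => ih (x', y') hlt
  exact this (x, y)

theorem eq_or_eq_of_metricGraph_adj (h : (metricGraph V).Adj x y) (hz : z ∈ metricInterval x y) :
    z = x ∨ z = y := by
  by_contra! hne
  exact absurd (mem_metricInterval.1 hz) (h.2 z hne.1 hne.2).ne'

theorem metricGraph_adj_of_forall (hne : x ≠ y) (h : ∀ z ∈ metricInterval x y, z = x ∨ z = y) :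
    (metricGraph V).Adj x y := by
  refine ⟨hne, fun z hx hy => ?_⟩
  by_contra! hle
  rcases h z (le_antisymm hle (dist_triangle x z y)) with h | h <;> contradiction

theorem exists_metricGraph_adj_mem_metricInterval [Finite V] (x y : V) (hne : x ≠ y) :
    ∃ z, (metricGraph V).Adj x z ∧ z ∈ metricInterval x y := by
  induction x, y using dist_induction with
  | h x y ih =>
    by_cases hadj : (metricGraph V).Adj x y
    · exact ⟨y, hadj, right_mem_metricInterval x y⟩
    · have : ∃ w ∈ metricInterval x y, w ≠ x ∧ w ≠ y := by
        by_contra! hcon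
        exact hadj (metricGraph_adj_of_forall hne fun z hz => or_iff_not_imp_left.2 (hcon z hz))
      obtain ⟨w, hw, hwx, hwy⟩ := this
      have hlt := dist_lt_of_mem_metricInterval (mem_metricInterval_symm hw) hwy
      rw [dist_comm, dist_comm y] at hlt
      obtain ⟨z, hxz, hz⟩ := ih x w hlt hwx.symm
      exact ⟨z, hxz, mem_metricInterval_symm
        (metricInterval_trans (mem_metricInterval_symm hw) (mem_metricInterval_symm hz))⟩

theorem IsModularMetric.exists_median (hV : IsModularMetric V) (x y z : V) :
    ∃ m, m ∈ metricInterval x y ∧ m ∈ metricInterval y z ∧ m ∈ metricInterval x z := by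
  obtain ⟨m, ⟨h₁, h₂⟩, h₃⟩ := hV x y z
  exact ⟨m, h₁, h₂, h₃⟩

/-- No edge is level with respect to `q`: the median of its ends and `q` lies on the edge, hence is
an end. -/
theorem IsModularMetric.mem_or_mem_of_adj (hV : IsModularMetric V)
    (h : (metricGraph V).Adj x y) (q : V) :
    x ∈ metricInterval y q ∨ y ∈ metricInterval x q := by
  obtain ⟨m, h₁, h₂, h₃⟩ := hV.exists_median x y q
  rcases eq_or_eq_of_metricGraph_adj h h₁ with rfl | rfl
  · exact Or.inl h₂
  · exact Or.inr h₃

theorem IsModularMetric.mem_metricInterval_of_adj_of_adj (hV : IsModularMetric V)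
    (hx : (metricGraph V).Adj w x) (hy : (metricGraph V).Adj w y) (hne : x ≠ y) :
    w ∈ metricInterval x y := by
  rcases hV.mem_or_mem_of_adj hx y with h | h
  · exact h
  · rcases eq_or_eq_of_metricGraph_adj hy h with h | h
    · exact absurd h hx.1.symm
    · exact absurd h hne

/-- In a metric rectangle `w x m y`, the side `x m` opposite to an edge `w y` is an edge. -/
theorem IsModularMetric.adj_of_rectangle (hV : IsModularMetric V) {m : V}
    (hwy : (metricGraph V).Adj w y) (hxm : dist x m = dist w y) (hmy : dist m y = dist w x)
    (hwm : dist w m = dist w x + dist w y) (hxy : dist x y = dist w x + dist w y) :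
    (metricGraph V).Adj x m := by
  have hpos : 0 < dist w y := dist_pos.2 hwy.1
  refine metricGraph_adj_of_forall (fun h => ?_) fun z hz => ?_
  · rw [h, dist_self] at hxm
    linarith
  · rw [mem_metricInterval] at hz
    have h₁ := dist_triangle w x z
    have h₂ := dist_triangle w z m
    have h₃ := dist_triangle x z y
    have h₄ := dist_triangle z m y
    -- The edge `w y` is not level with respect to `z`; the end nearer to `z` decides whether `z` is
    -- `x` or `m`.
    rcases hV.mem_or_mem_of_adj hwy z with h | h <;> rw [mem_metricInterval] at h
    · left
      apply dist_le_zero.1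
      linarith [dist_comm y z, dist_comm z x, dist_comm w y]
    · right
      apply dist_le_zero.1
      linarith [dist_comm y z]

/-- The quadrangle condition. -/
theorem IsModularMetric.exists_quadrangle (hV : IsModularMetric V)
    (hx : (metricGraph V).Adj w x) (hy : (metricGraph V).Adj w y) (hne : x ≠ y)
    (hxq : x ∈ metricInterval w q) (hyq : y ∈ metricInterval w q) :
    ∃ m, (metricGraph V).Adj x m ∧ (metricGraph V).Adj y m ∧ m ≠ w ∧
      m ∈ metricInterval x q ∧ m ∈ metricInterval y q := by
  obtain ⟨m, h₁, h₂, h₃⟩ := hV.exists_median x y q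
  have hw := hV.mem_metricInterval_of_adj_of_adj hx hy hne
  have ht := dist_triangle w m q
  have ht' := dist_triangle w x m
  rw [mem_metricInterval] at hxq hyq hw
  have e₁ := mem_metricInterval.1 h₁
  have e₂ := mem_metricInterval.1 h₂
  have e₃ := mem_metricInterval.1 h₃
  have c₁ := dist_comm x w
  have c₂ := dist_comm m y
  have c₃ := dist_comm x y
  have hxm : dist x m = dist w y := by linarith
  have hym : dist y m = dist w x := by linarith
  have hwm : dist w m = dist w x + dist w y := by linarith
  refine ⟨m, hV.adj_of_rectangle hy hxm (by linarith) hwm (by linarith),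
    hV.adj_of_rectangle hx hym (by linarith [dist_comm m x]) (by linarith) (by linarith),
    ?_, h₃, h₂⟩
  rintro rfl
  rw [dist_self] at hwm
  linarith [dist_pos.2 hx.1, dist_pos.2 hy.1]

/-- Metric convexity. -/
def IsMetricConvex (U : Set V) : Prop := ∀ x ∈ U, ∀ y ∈ U, metricInterval x y ⊆ U

/-- It suffices to check convexity at the neighbours of one end of an interval. -/
theorem isMetricConvex_of_adj [Finite V] {U : Set V}
    (h : ∀ x ∈ U, ∀ y ∈ U, (∀ x' ∈ U, dist x' y < dist x y → metricInterval x' y ⊆ U) →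
      ∀ z ∈ metricInterval x y, (metricGraph V).Adj x z → z ∈ U) : IsMetricConvex U := by
  intro x hx y hy
  induction x, y using dist_induction with
  | h x y ih =>
    intro z hz
    rcases eq_or_ne x z with rfl | hne
    · exact hx
    obtain ⟨t, ht, htz⟩ := exists_metricGraph_adj_mem_metricInterval x z hne
    have hz' := mem_metricInterval_symm hz
    have htz' := mem_metricInterval_symm htz
    have hty : t ∈ metricInterval x y := mem_metricInterval_symm (metricInterval_trans hz' htz')
    have hzt : z ∈ metricInterval t y :=
      mem_metricInterval_symm (metricInterval_trans_left hz' htz')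
    have htU := h x hx y hy (fun x' hx' hlt => ih x' y hlt hx' hy) t hty ht
    exact ih t y (dist_lt_of_mem_metricInterval hty ht.1.symm) htU hy hzt

/-- In a finite modular metric space, nonempty convex sets are gated. -/
theorem IsMetricConvex.exists_isGate [Finite V] (hV : IsModularMetric V) {U : Set V}
    (hU : IsMetricConvex U) (hne : U.Nonempty) (q : V) : ∃ g, IsGate U q g := by
  obtain ⟨g, hg, hmin⟩ := Set.exists_min_image U (dist q) U.toFinite hne
  refine ⟨g, hg, fun u hu => ?_⟩
  -- By convexity the median stays in `U`, and it lies between `q` and the nearest point `g`, so it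
  -- equals `g`.
  obtain ⟨m, h₁, h₂, h₃⟩ := hV.exists_median q g u
  have hm := hmin m (hU g hg u hu h₂)
  rw [mem_metricInterval] at h₁
  have : m = g := dist_le_zero.1 (by linarith)
  subst this
  exact h₃.symm

theorem IsGate.mem_metricInterval {U : Set V} {g u : V} (hg : IsGate U q g) (hu : u ∈ U) :
    g ∈ metricInterval u q := mem_metricInterval_symm (hg.2 u hu).symm

theorem isShortestSubpath_three : IsShortestSubpath ![x, y, z] ↔ y ∈ metricInterval x z := by
  simp [IsShortestSubpath, Fin.sum_univ_succ, _root_.mem_metricInterval, eq_comm]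

theorem intervalLE_iff : intervalLE x w y z ↔ dist x w = dist x y + dist y z + dist z w := by
  simp [intervalLE, IsShortestSubpath, Fin.sum_univ_succ, add_assoc]

theorem IsIntervalJoin.unique {j j' : V} (h : IsIntervalJoin x y z w j)
    (h' : IsIntervalJoin x y z w j') : j = j' := by
  have h₁ := intervalLE_iff.1 (h.2.2.2 j' h'.1 h'.2.1 h'.2.2.1)
  have h₂ := mem_metricInterval.1 h'.1
  have h₃ := intervalLE_iff.1 (h'.2.2.2 j h.1 h.2.1 h.2.2.1)
  have h₄ := mem_metricInterval.1 h.1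
  apply dist_le_zero.1
  linarith [dist_comm j j']

end MetricInterval

/-! ### The order of a modular complex: geodesics, convexity, order intervals -/

namespace ModularComplex

variable {V : Type*} [MetricSpace V] (Γ : ModularComplex V) {a b c p q u v x y z w g : V}

theorem le_refl (x : V) : Γ.le x x := Relation.ReflTransGen.refl

variable {Γ}

theorem le_trans (h : Γ.le x y) (h' : Γ.le y z) : Γ.le x z := Relation.ReflTransGen.trans h h'

theorem le_of_arrow (h : Γ.arrow x y) : Γ.le x y := Relation.ReflTransGen.single h

theorem adj_of_arrow (h : Γ.arrow x y) : (metricGraph V).Adj x y :=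
  (Γ.admissible.adj_iff x y).2 (Or.inl h)

/-- The modular complex with all arrows reversed. -/
def dual (Γ : ModularComplex V) : ModularComplex V where
  modular := Γ.modular
  arrow x y := Γ.arrow y x
  admissible :=
    { adj_iff := fun x y => (Γ.admissible.adj_iff x y).trans or_comm
      asymm := fun x y => Γ.admissible.asymm y x
      four_cycle := fun x₁ x₂ x₃ x₄ h₁₂ h₂₃ h₃₄ h₄₁ h₁₃ h₂₄ h =>
        Γ.admissible.four_cycle x₂ x₁ x₄ x₃ h₁₂.symm h₄₁.symm h₃₄.symm h₂₃.symm h₂₄ h₁₃ h }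

theorem dual_le : Γ.dual.le x y ↔ Γ.le y x := Relation.reflTransGen_swap

/-- Edges that are opposite in a 4-cycle `w x m y` have the same direction. -/
theorem arrow_of_quadrangle {m : V} (hwx : (metricGraph V).Adj w x)
    (hwy : (metricGraph V).Adj w y) (hxm : (metricGraph V).Adj x m)
    (hym : (metricGraph V).Adj y m) (hne : x ≠ y) (hmw : m ≠ w) (h : Γ.arrow w x) :
    Γ.arrow y m :=
  Γ.admissible.four_cycle w x m y hwx hxm hym.symm hwy.symm hmw.symm hne h


/-- There is a directed shortest path from the first vertex to the second. -/
inductive DirectedGeodesic (Γ : ModularComplex V) (q : V) : V → Prop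
  | refl : DirectedGeodesic Γ q q
  | step {x y : V} : Γ.arrow x y → y ∈ metricInterval x q → DirectedGeodesic Γ q y →
      DirectedGeodesic Γ q x

theorem DirectedGeodesic.le (h : Γ.DirectedGeodesic q x) : Γ.le x q := by
  induction h with
  | refl => exact Γ.le_refl q
  | step hxy _ _ ih => exact le_trans (le_of_arrow hxy) ih

variable [Finite V]

/-- One directed geodesic forces every first step toward `q` to be directed: the quadrangle
condition closes the two first steps to a 4-cycle one level nearer to `q`, and admissibility carries
orientations across it. -/
theorem DirectedGeodesic.of_adj (h : Γ.DirectedGeodesic q x) (hy : (metricGraph V).Adj x y)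
    (hyq : y ∈ metricInterval x q) : Γ.arrow x y ∧ Γ.DirectedGeodesic q y := by
  induction x, q using dist_induction generalizing y with
  | h x q ih =>
    cases h with
    | refl =>
      rw [mem_metricInterval, dist_self] at hyq
      exact absurd (dist_le_zero.1 (by linarith [dist_nonneg (x := y) (y := x)])) hy.1
    | @step _ a hxa haq ha =>
      rcases eq_or_ne a y with rfl | hne
      · exact ⟨hxa, ha⟩
      have hxa' := adj_of_arrow hxa
      obtain ⟨m, ham, hym, hmx, hm, hm'⟩ :=
        Γ.modular.exists_quadrangle hxa' hy hne haq hyq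
      obtain ⟨h₁, h₂⟩ := ih a q (dist_lt_of_mem_metricInterval haq hxa'.1.symm) ha ham hm
      exact ⟨arrow_of_quadrangle ham hxa'.symm hym.symm hy hmx hne.symm h₁,
        .step (arrow_of_quadrangle hxa' hy ham hym hne hmx hxa) hm' h₂⟩

/-- Were `x` nearer to `q` than `y`, the previous lemma would orient the edge from `y` to `x`. Hence
every directed path is a geodesic. -/
theorem mem_metricInterval_of_arrow_of_directedGeodesic (h : Γ.arrow x y)
    (hy : Γ.DirectedGeodesic q y) : y ∈ metricInterval x q := by
  rcases Γ.modular.mem_or_mem_of_adj (adj_of_arrow h) q with h' | h'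
  · exact absurd (hy.of_adj (adj_of_arrow h).symm h').1 (Γ.admissible.asymm x y h)
  · exact h'

theorem le_iff_directedGeodesic : Γ.le x q ↔ Γ.DirectedGeodesic q x := by
  refine ⟨fun h => ?_, DirectedGeodesic.le⟩
  induction h using Relation.ReflTransGen.head_induction_on with
  | refl => exact .refl
  | head hxy _ ih => exact .step hxy (mem_metricInterval_of_arrow_of_directedGeodesic hxy ih) ih

theorem arrow_of_adj_of_le (h : Γ.le x q) (hy : (metricGraph V).Adj x y)
    (hyq : y ∈ metricInterval x q) : Γ.arrow x y ∧ Γ.le y q := by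
  have := (le_iff_directedGeodesic.1 h).of_adj hy hyq
  exact ⟨this.1, this.2.le⟩

theorem mem_metricInterval_of_le_of_le (h : Γ.le x y) (h' : Γ.le y z) :
    y ∈ metricInterval x z := by
  induction h using Relation.ReflTransGen.head_induction_on with
  | refl => exact left_mem_metricInterval y z
  | @head a b hab hby ih =>
    exact metricInterval_trans (mem_metricInterval_of_arrow_of_directedGeodesic hab
      (le_iff_directedGeodesic.1 (le_trans hby h'))) ih

theorem le_and_le_of_mem_metricInterval (h : Γ.le x y) (hz : z ∈ metricInterval x y) :
    Γ.le x z ∧ Γ.le z y := by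
  induction x, y using dist_induction with
  | h x y ih =>
    rcases eq_or_ne x z with rfl | hne
    · exact ⟨Γ.le_refl x, h⟩
    obtain ⟨t, ht, htz⟩ := exists_metricGraph_adj_mem_metricInterval x z hne
    have hz' := mem_metricInterval_symm hz
    have htz' := mem_metricInterval_symm htz
    have hty : t ∈ metricInterval x y := mem_metricInterval_symm (metricInterval_trans hz' htz')
    have hzt : z ∈ metricInterval t y :=
      mem_metricInterval_symm (metricInterval_trans_left hz' htz')
    obtain ⟨hxt, hle⟩ := arrow_of_adj_of_le h ht hty
    have := ih t y (dist_lt_of_mem_metricInterval hty ht.1.symm) hle hzt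
    exact ⟨le_trans (le_of_arrow hxt) this.1, this.2⟩

/-- A convexity criterion for sets of upper bounds of `p` that contain, with `x`, the whole
interval `[p, x]`. -/
theorem isMetricConvex_of_isLowerSet {U : Set V} (hle : ∀ x ∈ U, Γ.le p x)
    (hdown : ∀ x ∈ U, ∀ y, Γ.le p y → Γ.le y x → y ∈ U)
    (hjoin : ∀ x ∈ U, ∀ y ∈ U, ∀ z, Γ.arrow x z → Γ.arrow y z → x ≠ y → z ∈ U) :
    IsMetricConvex U := by
  refine isMetricConvex_of_adj fun x hx y hy ih z hz hxz => ?_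
  obtain ⟨m, hmx, hmy, hpm⟩ := Γ.modular.exists_median p x y
  have hm := le_and_le_of_mem_metricInterval (hle x hx) hmx
  have hm' := le_and_le_of_mem_metricInterval (hle y hy) hpm
  have of_le : Γ.le x y → z ∈ U := fun hxy => by
    have := arrow_of_adj_of_le hxy hxz hz
    exact hdown y hy z (le_trans (hle x hx) (le_of_arrow this.1)) this.2
  rcases eq_or_ne x m with rfl | hne
  · exact of_le hm'.2
  obtain ⟨a, hxa, ham⟩ := exists_metricGraph_adj_mem_metricInterval x m hne
  have ha := le_and_le_of_mem_metricInterval hm.2 (mem_metricInterval_symm ham)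
  have hpa := le_trans hm.1 ha.1
  rcases eq_or_ne a z with rfl | haz
  · exact hdown x hx a hpa ha.2
  have hay : a ∈ metricInterval x y := mem_metricInterval_symm (metricInterval_trans
    (mem_metricInterval_symm hmy) (mem_metricInterval_symm ham))
  -- In the square `x a n z`, induction from `a` gives `n ∈ U`, and `a → x` transports to `n → z`.
  -- So `z` either covers both `x` and `n`, or lies in `[p, x]`.
  obtain ⟨n, han, hzn, hnx, hn, hn'⟩ := Γ.modular.exists_quadrangle hxa hxz haz hay hz
  have hnU := ih a (hdown x hx a hpa ha.2) (dist_lt_of_mem_metricInterval hay hxa.1.symm) hn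
  have hax : Γ.arrow a x := (arrow_of_adj_of_le ha.2 hxa.symm (right_mem_metricInterval a x)).1
  have hnz : Γ.arrow n z := arrow_of_quadrangle hxa.symm han hxz hzn.symm hnx.symm haz.symm hax
  rcases (Γ.admissible.adj_iff x z).1 hxz with h | h
  · exact hjoin x hx n hnU z h hnz hnx.symm
  · exact hdown x hx z (le_trans (hle n hnU) (le_of_arrow hnz)) (le_of_arrow h)

theorem isMetricConvex_setOf_ge (p : V) : IsMetricConvex {x | Γ.le p x} :=
  isMetricConvex_of_isLowerSet (p := p) (fun _ h => h) (fun _ _ _ h _ => h)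
    fun _ hx _ _ _ h _ _ => le_trans hx (le_of_arrow h)

theorem isMetricConvex_setOf_le (p : V) : IsMetricConvex {x | Γ.le x p} := by
  have := isMetricConvex_setOf_ge (Γ := Γ.dual) p
  simpa only [dual_le] using this

theorem isMetricConvex_interval (a b : V) : IsMetricConvex (Γ.interval a b) :=
  fun x hx y hy _ hz => ⟨isMetricConvex_setOf_ge a x hx.1 y hy.1 hz,
    isMetricConvex_setOf_le b x hx.2 y hy.2 hz⟩

theorem isJoin_of_mem_metricInterval (hx : Γ.le x z) (hy : Γ.le y z)
    (hz : z ∈ metricInterval x y) : Γ.IsJoin x y z :=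
  ⟨hx, hy, fun w hxw hyw => isMetricConvex_setOf_le w x hxw y hyw hz⟩

theorem isMeet_of_mem_metricInterval (hx : Γ.le z x) (hy : Γ.le z y)
    (hz : z ∈ metricInterval x y) : Γ.IsMeet x y z :=
  ⟨hx, hy, fun w hxw hyw => isMetricConvex_setOf_ge w x hxw y hyw hz⟩

theorem exists_upper_median (hx : Γ.le x w) (hy : Γ.le y w) :
    ∃ j, Γ.le x j ∧ Γ.le y j ∧ Γ.le j w ∧ j ∈ metricInterval x y := by
  obtain ⟨j, h₁, h₂, h₃⟩ := Γ.modular.exists_median x y w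
  exact ⟨j, (le_and_le_of_mem_metricInterval hx h₃).1, (le_and_le_of_mem_metricInterval hy h₂).1,
    (le_and_le_of_mem_metricInterval hx h₃).2, h₁⟩

theorem exists_lower_median (hx : Γ.le w x) (hy : Γ.le w y) :
    ∃ m, Γ.le m x ∧ Γ.le m y ∧ Γ.le w m ∧ m ∈ metricInterval x y := by
  obtain ⟨m, h₁, h₂, h₃, h₄⟩ := exists_upper_median (dual_le.2 hx) (dual_le.2 hy)
  exact ⟨m, dual_le.1 h₁, dual_le.1 h₂, dual_le.1 h₃, h₄⟩

theorem exists_isGate_interval (hab : Γ.le a b) (q : V) : ∃ g, IsGate (Γ.interval a b) q g :=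
  (isMetricConvex_interval a b).exists_isGate Γ.modular ⟨a, Γ.le_refl a, hab⟩ q

/-- The points `p, u, g, v` form a metric rectangle. Both diagonals have the same length because the
two expansions of `dist p g` add up to the two expansions of `dist v u`. -/
theorem isGate_interval_aux (hv : Γ.le v p) (hu : Γ.le p u) (huz : u ∈ metricInterval p z)
    (hvz : v ∈ metricInterval p z) (hg : IsGate (Γ.interval v u) z g) :
    g ∈ metricInterval p z ∧ dist p g = dist v u ∧ u ∈ metricInterval p g ∧
      v ∈ metricInterval p g := by
  have hvu := le_trans hv hu
  have h₁ := hg.mem_metricInterval (u := u) ⟨hvu, Γ.le_refl u⟩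
  have h₂ := hg.mem_metricInterval (u := v) ⟨Γ.le_refl v, hvu⟩
  have h₃ := mem_metricInterval_of_le_of_le hg.1.1 hg.1.2
  have h₄ := mem_metricInterval_of_le_of_le hv hu
  have h₅ := metricInterval_trans huz h₁
  have h₆ := metricInterval_trans_left huz h₁
  have h₇ := metricInterval_trans_left hvz h₂
  refine ⟨h₅, ?_, h₆, h₇⟩
  rw [mem_metricInterval] at *
  linarith [dist_comm p v, dist_comm u g]

/-- If `v ⪯ p ⪯ u` and `u, v ∈ I(p, q)`, then the join of `u` and `v` in `I(p, q)` is the gate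
of `q` at `[v, u]`. -/
theorem isIntervalJoin_of_isGate (hv : Γ.le v p) (hu : Γ.le p u) (huq : u ∈ metricInterval p q)
    (hvq : v ∈ metricInterval p q) (hg : IsGate (Γ.interval v u) q g) :
    IsIntervalJoin p q u v g := by
  obtain ⟨h₁, h₂, h₃, h₄⟩ := isGate_interval_aux hv hu huq hvq hg
  simp only [IsIntervalJoin, intervalLE_iff]
  rw [mem_metricInterval] at h₁ h₃ h₄
  refine ⟨h₁, by linarith, by linarith, fun z hz huz hvz => ?_⟩
  rw [mem_metricInterval] at hz
  -- The gate of an upper bound `z` is as far from `p` as `g` is, namely `dist v u`, and `g` lies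
  -- between it and `q`; so the two gates agree.
  obtain ⟨h, hh⟩ := exists_isGate_interval (le_trans hv hu) z
  obtain ⟨k₁, k₂, -, -⟩ := isGate_interval_aux (z := z) hv hu
    (by rw [mem_metricInterval]; linarith) (by rw [mem_metricInterval]; linarith) hh
  have k₃ := hg.mem_metricInterval hh.1
  rw [mem_metricInterval] at k₁ k₃
  have : h = g := dist_le_zero.1 (by linarith [dist_triangle h z q])
  subst this
  linarith

end ModularComplex

/-! ### The gates `p ▷ q`, `p ◁ q` and the operation `p ◇ q` -/

namespace ExtendedModularComplex

variable {V : Type*} [MetricSpace V] (Γ : ExtendedModularComplex V) {a b p q u v x y z w g : V}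

open ModularComplex

/-- The extended modular complex with arrows and relation reversed. -/
def dual : ExtendedModularComplex V where
  toModularComplex := Γ.toModularComplex.dual
  rel x y := Γ.rel y x
  rel_admissible :=
    { le_of_rel := fun p q h => dual_le.2 (Γ.rel_admissible.le_of_rel q p h)
      refl := Γ.rel_admissible.refl
      of_arrow := fun p q h => Γ.rel_admissible.of_arrow q p h
      of_mem_interval := fun p q a b h hab ha hb =>
        Γ.rel_admissible.of_mem_interval q p b a h (dual_le.1 hab)
          ⟨dual_le.1 hb.2, dual_le.1 hb.1⟩ ⟨dual_le.1 ha.2, dual_le.1 ha.1⟩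
      join := fun p q₁ q₂ j h₁ h₂ hj => Γ.rel_admissible.meet q₁ q₂ p j h₁ h₂
        ⟨dual_le.1 hj.1, dual_le.1 hj.2.1,
          fun z hz hz' => dual_le.1 (hj.2.2 z (dual_le.2 hz) (dual_le.2 hz'))⟩
      meet := fun p₁ p₂ q m h₁ h₂ hm => Γ.rel_admissible.join q p₁ p₂ m h₁ h₂
        ⟨dual_le.1 hm.1, dual_le.1 hm.2.1,
          fun z hz hz' => dual_le.1 (hm.2.2 z (dual_le.2 hz) (dual_le.2 hz'))⟩ }

variable {Γ}

theorem le_of_rel (h : Γ.rel x y) : Γ.le x y := Γ.rel_admissible.le_of_rel x y h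

theorem rel_of_le_of_le_of_le (h : Γ.rel a b) (hax : Γ.le a x) (hxy : Γ.le x y)
    (hyb : Γ.le y b) : Γ.rel x y :=
  Γ.rel_admissible.of_mem_interval a b x y h hxy ⟨hax, le_trans hxy hyb⟩ ⟨le_trans hax hxy, hyb⟩

theorem diamondNeighbors_of_adj (h : (metricGraph V).Adj x y) : Γ.DiamondNeighbors x y := by
  rcases (Γ.admissible.adj_iff x y).1 h with h | h
  · exact ⟨x, y, Γ.rel_admissible.of_arrow x y h, ⟨Γ.le_refl x, le_of_arrow h⟩,
      ⟨le_of_arrow h, Γ.le_refl y⟩⟩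
  · exact ⟨y, x, Γ.rel_admissible.of_arrow y x h, ⟨le_of_arrow h, Γ.le_refl x⟩,
      ⟨Γ.le_refl y, le_of_arrow h⟩⟩

/-- Ensures that consecutive iterates differ before `q` is reached, as the loopless thickening
requires. -/
theorem diamondIter_stable {i : ℕ} (h : Γ.diamondIter p q (i + 1) = Γ.diamondIter p q i) (j : ℕ) :
    Γ.diamondIter p q (i + j) = Γ.diamondIter p q i := by
  induction j with
  | zero => rfl
  | succ j ih =>
    change Γ.diamond (Γ.diamondIter p q (i + j)) q = _
    rw [ih]
    exact h

variable [Finite V]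

theorem isMetricConvex_upperNbhd (p : V) : IsMetricConvex (Γ.upperNbhd p) := by
  refine isMetricConvex_of_isLowerSet (Γ := Γ.toModularComplex) (p := p) (fun _ => le_of_rel)
    (fun x hx y hpy hyx => rel_of_le_of_le_of_le hx (Γ.le_refl p) hpy hyx)
    fun x hx y hy z hxz hyz hne => ?_
  have hz : z ∈ metricInterval x y := Γ.modular.mem_metricInterval_of_adj_of_adj
    (adj_of_arrow hxz).symm (adj_of_arrow hyz).symm hne
  exact Γ.rel_admissible.join p x y z hx hy
    (isJoin_of_mem_metricInterval (le_of_arrow hxz) (le_of_arrow hyz) hz)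

theorem isMetricConvex_lowerNbhd (p : V) : IsMetricConvex (Γ.lowerNbhd p) :=
  isMetricConvex_upperNbhd (Γ := Γ.dual) p

variable (Γ)

theorem isGate_upGate (p q : V) : IsGate (Γ.upperNbhd p) q (Γ.upGate p q) :=
  Classical.epsilon_spec ((isMetricConvex_upperNbhd p).exists_isGate Γ.modular
    ⟨p, Γ.rel_admissible.refl p⟩ q)

theorem isGate_downGate (p q : V) : IsGate (Γ.lowerNbhd p) q (Γ.downGate p q) :=
  Classical.epsilon_spec ((isMetricConvex_lowerNbhd p).exists_isGate Γ.modular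
    ⟨p, Γ.rel_admissible.refl p⟩ q)

theorem rel_upGate (p q : V) : Γ.rel p (Γ.upGate p q) := (Γ.isGate_upGate p q).1

theorem downGate_rel (p q : V) : Γ.rel (Γ.downGate p q) p := (Γ.isGate_downGate p q).1

theorem upGate_mem (p q : V) : Γ.upGate p q ∈ metricInterval p q :=
  (Γ.isGate_upGate p q).mem_metricInterval (Γ.rel_admissible.refl p)

theorem downGate_mem (p q : V) : Γ.downGate p q ∈ metricInterval p q :=
  (Γ.isGate_downGate p q).mem_metricInterval (Γ.rel_admissible.refl p)

theorem isGate_diamond (p q : V) :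
    IsGate (Γ.interval (Γ.downGate p q) (Γ.upGate p q)) q (Γ.diamond p q) ∧
      IsIntervalJoin p q (Γ.upGate p q) (Γ.downGate p q) (Γ.diamond p q) := by
  have hv := le_of_rel (Γ.downGate_rel p q)
  have hu := le_of_rel (Γ.rel_upGate p q)
  obtain ⟨g, hg⟩ := exists_isGate_interval (le_trans hv hu) q
  have hj := isIntervalJoin_of_isGate hv hu (Γ.upGate_mem p q) (Γ.downGate_mem p q) hg
  have hd : IsIntervalJoin p q (Γ.upGate p q) (Γ.downGate p q) (Γ.diamond p q) :=
    Classical.epsilon_spec ⟨g, hj⟩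
  exact ⟨hj.unique hd ▸ hg, hd⟩

theorem diamond_mem (p q : V) : Γ.diamond p q ∈ metricInterval p q := (Γ.isGate_diamond p q).2.1

variable {Γ}

/-- A diamond-neighbor of `p` is at least as far from `q` as `p ◇ q`, on a shortest subpath. -/
theorem DiamondNeighbors.diamond_mem (h : Γ.DiamondNeighbors p x) (q : V) :
    Γ.diamond p q ∈ metricInterval x q := by
  obtain ⟨a, b, hab, hp, hx⟩ := h
  obtain ⟨g, hg⟩ := exists_isGate_interval (le_of_rel hab) q
  have hpg := hg.mem_metricInterval hp
  -- Join `u` and meet `v` of `p` and `g` satisfy `p ⊑ u` and `v ⊑ p`, so the gates `p ▷ q` and `p ◁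
  -- q` lie beyond them on the way to `q`.
  obtain ⟨u, hpu, hgu, hub, hu⟩ := exists_upper_median hp.2 hg.1.2
  obtain ⟨v, hvp, hvg, hav, hv⟩ := exists_lower_median hp.1 hg.1.1
  have hu' := (Γ.isGate_upGate p q).2 u (rel_of_le_of_le_of_le hab hp.1 hpu hub)
  have hv' := (Γ.isGate_downGate p q).2 v (rel_of_le_of_le_of_le hab hav hvp hp.2)
  have hju := intervalLE_iff.1 (Γ.isGate_diamond p q).2.2.1
  have hjv := intervalLE_iff.1 (Γ.isGate_diamond p q).2.2.2.1
  have hpq := Γ.diamond_mem p q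
  set d := Γ.diamond p q
  set u' := Γ.upGate p q
  set v' := Γ.downGate p q
  rw [mem_metricInterval] at hpg hu hv hpq
  have hud : u ∈ metricInterval p d := by
    rw [mem_metricInterval]
    linarith [dist_triangle p u d, dist_triangle u u' d, dist_triangle p u u', dist_comm u u',
      dist_comm q u', dist_comm q u, dist_triangle u g q, dist_triangle p u q,
      dist_triangle p u' q]
  have hvd : v ∈ metricInterval p d := by
    rw [mem_metricInterval]
    linarith [dist_triangle p v d, dist_triangle v v' d, dist_triangle p v v', dist_comm v v',
      dist_comm q v', dist_comm q v, dist_triangle v g q, dist_triangle p v q,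
      dist_triangle p v' q]
  -- The gate `t` of `d` at `[v, u]` is at distance `dist v u = dist p g` from `p`, and `g` lies
  -- between `t` and `q`. Hence `t = g`, which places `g` before `d`.
  obtain ⟨t, ht⟩ := exists_isGate_interval (le_trans hvp hpu) d
  obtain ⟨k₁, k₂, -, -⟩ := isGate_interval_aux hvp hpu hud hvd ht
  have k₃ := mem_metricInterval_of_le_of_le hvp hpu
  have k₄ := mem_metricInterval_of_le_of_le hvg hgu
  have k₅ := hg.mem_metricInterval (u := t) ⟨le_trans hav ht.1.1, le_trans ht.1.2 hub⟩
  rw [mem_metricInterval] at k₁ k₃ k₄ k₅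
  have : t = g := dist_le_zero.1 (by
    linarith [dist_triangle t d q, dist_comm v p, dist_comm u g])
  subst this
  have htd : d ∈ metricInterval t q := by
    rw [mem_metricInterval]
    linarith
  exact metricInterval_trans (hg.mem_metricInterval hx) htd

/-- The relation descends along a metric rectangle `v ⪯ p, y ⪯ u`. -/
theorem rel_of_rectangle (hvp : Γ.le v p) (hpu : Γ.rel p u) (hvy : Γ.le v y) (hyu : Γ.le y u)
    (hu : u ∈ metricInterval p y) (hv : v ∈ metricInterval p y) : Γ.rel v y := by
  have hpu' := le_of_rel hpu
  induction u, y using dist_induction generalizing p with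
  | h u y ih =>
    have e₁ := mem_metricInterval_of_le_of_le hvp hpu'
    have e₂ := mem_metricInterval_of_le_of_le hvy hyu
    rcases eq_or_ne u y with rfl | hne
    · have : v = p := by
        rw [mem_metricInterval] at *
        apply dist_le_zero.1
        linarith [dist_comm p v, dist_self u]
      exact this ▸ hpu
    · obtain ⟨z, huz, hz⟩ := exists_metricGraph_adj_mem_metricInterval u y hne
      have hz' := le_and_le_of_mem_metricInterval hyu (mem_metricInterval_symm hz)
      have hzu := (arrow_of_adj_of_le hz'.2 huz.symm (right_mem_metricInterval z u)).1
      -- With `z` one step below `u`, the meet axiom gives `p ∧ z = t ⊑ u`, hence `t ⊑ z`; the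
      -- shorter rectangle `v, t, z, y` remains.
      obtain ⟨t, htp, htz, hvt, ht⟩ := exists_lower_median hvp (le_trans hvy hz'.1)
      have htu := Γ.rel_admissible.meet p z u t hpu (Γ.rel_admissible.of_arrow z u hzu)
        (isMeet_of_mem_metricInterval htp htz ht)
      have htz'' := rel_of_le_of_le_of_le htu (Γ.le_refl t) htz hz'.2
      have hvt' := mem_metricInterval_of_le_of_le hvt htp
      refine ih z y (dist_lt_of_mem_metricInterval hz huz.1.symm) hvt htz'' hvy hz'.1 ?_ ?_
        (le_of_rel htz'')
      · have e₃ := mem_metricInterval_of_le_of_le htp hpu'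
        have e₄ := mem_metricInterval_of_le_of_le htz hz'.2
        rw [mem_metricInterval] at *
        linarith [dist_comm p v, dist_comm p t, dist_comm t v, dist_comm z u, dist_comm u y,
          dist_comm z y, dist_triangle t z y, dist_triangle t v y, dist_triangle p u z,
          dist_triangle p t y]
      · rw [mem_metricInterval] at *
        linarith [dist_comm p v, dist_comm p t, dist_comm t v, dist_triangle t v y,
          dist_triangle p t y]

variable (Γ)

theorem downGate_rel_upGate (p q : V) : Γ.rel (Γ.downGate p q) (Γ.upGate p q) := by
  have hv := le_of_rel (Γ.downGate_rel p q)
  have hu := le_of_rel (Γ.rel_upGate p q)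
  have hg := (Γ.isGate_diamond p q).1
  obtain ⟨-, -, h₁, h₂⟩ := isGate_interval_aux hv hu (Γ.upGate_mem p q) (Γ.downGate_mem p q) hg
  have := rel_of_rectangle hv (Γ.rel_upGate p q) hg.1.1 hg.1.2 h₁ h₂
  -- The rectangle gives `p ◁ q ⊑ p ◇ q`, and `p ▷ q` is the join of `p` and `p ◇ q`.
  exact Γ.rel_admissible.join _ p _ _ (Γ.downGate_rel p q) this
    (isJoin_of_mem_metricInterval hu hg.1.2 h₁)

theorem diamondNeighbors_diamond (p q : V) : Γ.DiamondNeighbors p (Γ.diamond p q) :=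
  ⟨_, _, Γ.downGate_rel_upGate p q, ⟨le_of_rel (Γ.downGate_rel p q), le_of_rel (Γ.rel_upGate p q)⟩,
    (Γ.isGate_diamond p q).1.1⟩

variable {Γ}

/-- A neighbor `x` of `p` toward `q` lies in `[p ◁ q, p ▷ q]` by the gate property, so `p ◇ q` is a
`◇`-neighbor of `x`. -/
theorem diamond_mem_of_adj (h : (metricGraph V).Adj p x) (hx : x ∈ metricInterval p q) :
    Γ.diamond x q ∈ metricInterval (Γ.diamond p q) q := by
  refine DiamondNeighbors.diamond_mem ?_ q
  have hv := le_of_rel (Γ.downGate_rel p q)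
  have hu := le_of_rel (Γ.rel_upGate p q)
  refine ⟨_, _, Γ.downGate_rel_upGate p q, ?_, (Γ.isGate_diamond p q).1.1⟩
  rw [mem_metricInterval] at hx
  rcases (Γ.admissible.adj_iff p x).1 h with h | h
  · have hg := (Γ.isGate_upGate p q).2 x (Γ.rel_admissible.of_arrow p x h)
    have hpu := mem_metricInterval.1 (Γ.upGate_mem p q)
    have := le_and_le_of_mem_metricInterval (z := x) hu (by
      rw [mem_metricInterval]
      linarith [dist_comm q x, dist_comm q (Γ.upGate p q), dist_comm x (Γ.upGate p q)])
    exact ⟨le_trans hv this.1, this.2⟩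
  · have hg := (Γ.isGate_downGate p q).2 x (Γ.rel_admissible.of_arrow x p h)
    have hpv := mem_metricInterval.1 (Γ.downGate_mem p q)
    have := le_and_le_of_mem_metricInterval (z := x) hv (mem_metricInterval_symm (by
      rw [mem_metricInterval]
      linarith [dist_comm q x, dist_comm q (Γ.downGate p q), dist_comm x (Γ.downGate p q)]))
    exact ⟨this.1, le_trans this.2 hu⟩

/-- Monotonicity of `p ↦ p ◇ q`. -/
theorem diamond_mem_of_mem (hx : x ∈ metricInterval p q) :
    Γ.diamond x q ∈ metricInterval (Γ.diamond p q) q := by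
  induction p, x using dist_induction with
  | h p x ih =>
    rcases eq_or_ne p x with rfl | hne
    · exact left_mem_metricInterval _ _
    obtain ⟨t, ht, htx⟩ := exists_metricGraph_adj_mem_metricInterval p x hne
    have hx' := mem_metricInterval_symm hx
    have htx' := mem_metricInterval_symm htx
    have htq : t ∈ metricInterval p q := mem_metricInterval_symm (metricInterval_trans hx' htx')
    exact metricInterval_trans (diamond_mem_of_adj ht htq)
      (ih t x (dist_lt_of_mem_metricInterval htx ht.1.symm)
        (mem_metricInterval_symm (metricInterval_trans_left hx' htx')))

/-! ### Comparison with arbitrary `◇`-paths and the normal path -/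

theorem getVert_diamondIter_mem {r : V} (P : Γ.thickening.Walk p r) (i : ℕ)
    (hi : i ≤ P.length) : Γ.diamondIter p q i ∈ metricInterval (P.getVert i) q := by
  induction i with
  | zero => simpa [diamondIter] using left_mem_metricInterval p q
  | succ i ih =>
    have hadj := P.adj_getVert_succ (i := i) (by omega)
    -- The point `p_i ◇ q` is intermediate: the step to `p_{i+1}` does not pass it, and by
    -- monotonicity `p ◇^(i+1) q` is beyond it.
    exact metricInterval_trans (hadj.2.diamond_mem q) (diamond_mem_of_mem (ih (by omega)))

theorem diamondIter_length_eq (P : Γ.thickening.Walk p q) :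
    Γ.diamondIter p q P.length = q := by
  have := getVert_diamondIter_mem (q := q) P P.length le_rfl
  rw [SimpleGraph.Walk.getVert_length, mem_metricInterval, dist_self] at this
  exact dist_le_zero.1 (by linarith [dist_nonneg (x := q) (y := Γ.diamondIter p q P.length)])

theorem thickening_reachable (Γ : ExtendedModularComplex V) (p q : V) :
    Γ.thickening.Reachable p q := by
  induction p, q using dist_induction with
  | h p q ih =>
    rcases eq_or_ne p q with rfl | hne
    · exact SimpleGraph.Reachable.refl p
    obtain ⟨t, ht, htq⟩ := exists_metricGraph_adj_mem_metricInterval p q hne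
    have hadj : Γ.thickening.Adj p t := ⟨ht.1, diamondNeighbors_of_adj ht⟩
    exact hadj.reachable.trans (ih t q (dist_lt_of_mem_metricInterval htq ht.1.symm))

theorem exists_walk_diamondIter (n : ℕ)
    (hne : ∀ i < n, Γ.diamondIter p q (i + 1) ≠ Γ.diamondIter p q i) :
    ∃ P : Γ.thickening.Walk p (Γ.diamondIter p q n), P.length = n ∧
      ∀ i ≤ n, P.getVert i = Γ.diamondIter p q i := by
  induction n with
  | zero => exact ⟨.nil, rfl, fun i hi => by simp [Nat.le_zero.1 hi, diamondIter]⟩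
  | succ n ih =>
    obtain ⟨P, hP, hP'⟩ := ih fun i hi => hne i (by omega)
    have hadj : Γ.thickening.Adj (Γ.diamondIter p q n) (Γ.diamondIter p q (n + 1)) :=
      ⟨(hne n (by omega)).symm, Γ.diamondNeighbors_diamond _ q⟩
    refine ⟨P.concat hadj, by simp [hP], fun i hi => ?_⟩
    rcases Nat.lt_or_ge n i with h | h
    · obtain rfl : i = n + 1 := by omega
      have := (P.concat hadj).getVert_length
      rwa [SimpleGraph.Walk.length_concat, hP] at this
    · rw [SimpleGraph.Walk.concat_eq_append, SimpleGraph.Walk.getVert_append]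
      rcases Nat.lt_or_ge i n with h' | h'
      · simp [hP, h', hP' i h]
      · obtain rfl : i = n := by omega
        simp [hP]

theorem exists_isNormalPath (Γ : ExtendedModularComplex V) (p q : V) :
    ∃ P : Γ.thickening.Walk p q, Γ.IsNormalPath P ∧ P.length = Γ.thickening.dist p q := by
  obtain ⟨P₀, hP₀⟩ := (thickening_reachable Γ p q).exists_walk_length_eq_dist
  have hex : ∃ k, Γ.diamondIter p q k = q := ⟨P₀.length, diamondIter_length_eq P₀⟩
  classical
  obtain ⟨n, hn, hmin⟩ : ∃ n, Γ.diamondIter p q n = q ∧ ∀ k, Γ.diamondIter p q k = q → n ≤ k :=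
    ⟨Nat.find hex, Nat.find_spec hex, fun k hk => Nat.find_min' hex hk⟩
  have hne : ∀ i < n, Γ.diamondIter p q (i + 1) ≠ Γ.diamondIter p q i := fun i hi h => by
    have := diamondIter_stable h (n - i)
    rw [Nat.add_sub_cancel' hi.le, hn] at this
    exact absurd (hmin i this.symm) (by omega)
  obtain ⟨P, hP, hP'⟩ := exists_walk_diamondIter n hne
  -- The endpoint is generalized to `r` so that the equation `p ◇^n q = q` can be substituted into
  -- the type of the walk.
  have key : ∀ (r : V) (Q : Γ.thickening.Walk p r), r = q → Q.length = n →
      (∀ i ≤ n, Q.getVert i = Γ.diamondIter p q i) →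
      ∃ P : Γ.thickening.Walk p q, Γ.IsNormalPath P ∧ P.length = Γ.thickening.dist p q := by
    rintro r Q rfl hQ hQ'
    refine ⟨Q, ⟨⟨?_, fun k hk => ?_⟩, fun i hi => hQ' i (hQ ▸ hi)⟩, ?_⟩
    · exact diamondIter_length_eq Q
    · exact hQ ▸ hmin k hk
    · refine _root_.le_antisymm ?_ (SimpleGraph.dist_le Q)
      rw [hQ, ← hP₀]
      exact hmin _ (diamondIter_length_eq P₀)
  exact key _ P hn hP hP'

end ExtendedModularComplex

theorem mainTheorem9 {V : Type*} [Finite V] [MetricSpace V] (Γ : ExtendedModularComplex V)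
    (p q : V) :
    -- the gates `p ▷ q`, `p ◁ q` and the join `p ◇ q` exist
    (IsGate (Γ.upperNbhd p) q (Γ.upGate p q) ∧
      IsGate (Γ.lowerNbhd p) q (Γ.downGate p q) ∧
      IsIntervalJoin p q (Γ.upGate p q) (Γ.downGate p q) (Γ.diamond p q)) ∧
    -- every `◇`-path starting at `p`
    (∀ (r : V) (P : Γ.thickening.Walk p r),
      (∀ i ≤ P.length, IsShortestSubpath ![P.getVert i, Γ.diamondIter p q i, q]) ∧
      (r = q → Γ.diamondIter p q P.length = q)) ∧
    -- the normal `p`-`q` path exists and is a shortest `◇`-path from `p` to `q`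
    (∃ P : Γ.thickening.Walk p q, Γ.IsNormalPath P ∧ P.length = Γ.thickening.dist p q) := by
  refine ⟨⟨Γ.isGate_upGate p q, Γ.isGate_downGate p q, (Γ.isGate_diamond p q).2⟩,
    fun r P => ⟨fun i hi => isShortestSubpath_three.2
      (ExtendedModularComplex.getVert_diamondIter_mem P i hi), ?_⟩,
    ExtendedModularComplex.exists_isNormalPath Γ p q⟩
  rintro rfl
  exact ExtendedModularComplex.diamondIter_length_eq P
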